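/- Let $k$ be an arbitrary field, $n\ge 2$, and $R=k[x_1,\dots,x_n]$. Let $F=\{\mathbf x^{v_1},\dots,\mathbf x^{v_n}\}\subset R$ be a monomial Cremona set of degree $2$. This means that $F$ consists of $n$ distinct monomials of degree $2$ satisfying the canonical restrictions (they have no non-trivial common factor, and every variable divides at least one of them) and that the rational map $\mathbb P^{n-1}\dashrightarrow\mathbb P^{n-1}$ with coordinates $F$ is birational, i.e. $k[F]$ has the same field of fractions as the Veronese subring $R^{(2)}$ generated by all monomials of degree $2$. Let $G_F$ be the graph whose vertices are $x_1,\dots,x_n$ and whose edges are the elements of $F$, where $x_ux_v$ joins $x_u$ and $x_v$ and a square $x_u^2$ is a loop at $x_u$. Then there is exactly one ordered $n$-tuple $F^{-1}$ of monomials of a common positive degree that satisfies the canonical restrictions and defines the rational map inverse to that of $F$, and $G_F$ contains exactly one circuit (a loop being a circuit of length $1$). Let $r$ be the length of this circuit, let $s$ be the number of vertices of $G_F$ off the circuit whose vertex degree is at least $2$, and let $s_2$ be the number of edges in the second neighborhood of the circuit, i.e. of edges joining a vertex at distance $1$ from the circuit to a vertex at distance $2$ from it. The following conditions are equivalent: (a)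 $F$ is a $p$-involution, i.e. $F$ coincides with $F^{-1}$ up to a permutation of the variables (source) and a permutation of the monomials (target); (b) the monomials of $F^{-1}$ have degree $2$; (c) either $r=3$ (triangle) and $s_2=0$, or else $r=1$ (loop) and $s=1$. -/

import Mathlib

open MvPolynomial

noncomputable section

namespace MonomialCremona

/-! ### Sets of monomials

A finite set of `n` monomials in `n` variables over `k` is given by the family of its exponent
vectors `V : Fin n → (Fin n →₀ ℕ)`; the vectors `V j` are the columns of the log-matrix. -/

/-- All the vectors have the same modulus `d`. -/
def IsStochastic {n : ℕ} (d : ℕ) (V : Fin n → (Fin n →₀ ℕ)) : Prop :=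
  ∀ j, (V j).degree = d

/-- The canonical restrictions: the monomials have no common factor, and every variable
occurs in some monomial. -/
def CanonicalRestrictions {n : ℕ} (V : Fin n → (Fin n →₀ ℕ)) : Prop :=
  (∀ i, ∃ j, V j i = 0) ∧ (∀ i, ∃ j, V j i ≠ 0)

/-- The monomials with exponent vectors `V`. -/
def monomials (k : Type*) [Field k] {n : ℕ} (V : Fin n → (Fin n →₀ ℕ)) :
    Fin n → MvPolynomial (Fin n) k :=
  fun j => monomial (V j) 1

/-- The Veronese subring `R^(d)` of `R = k[x_1, …, x_n]`: the subalgebra generated by all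
monomials of degree `d`. -/
def veronese (k : Type*) [Field k] (n d : ℕ) : Subalgebra k (MvPolynomial (Fin n) k) :=
  Algebra.adjoin k {f | ∃ a : Fin n →₀ ℕ, a.degree = d ∧ f = monomial a 1}

/-- The field of fractions of a subalgebra of `k[x_1, …, x_n]`, taken inside
`k(x_1, …, x_n)`. -/
def fractionSubfield {k : Type*} [Field k] {n : ℕ} (A : Subalgebra k (MvPolynomial (Fin n) k)) :
    IntermediateField k (FractionRing (MvPolynomial (Fin n) k)) :=
  IntermediateField.adjoin k
    (algebraMap (MvPolynomial (Fin n) k) (FractionRing (MvPolynomial (Fin n) k)) '' A)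

/-- An extension `A ⊆ B` of subalgebras is birational if the fields of fractions agree. -/
def IsBirationalExtension {k : Type*} [Field k] {n : ℕ}
    (A B : Subalgebra k (MvPolynomial (Fin n) k)) : Prop :=
  A ≤ B ∧ fractionSubfield A = fractionSubfield B

/-- `V` is (the set of exponent vectors of) a monomial Cremona set of degree `d` over `k`:
`n` distinct monomials of degree `d ≥ 1` in `n` variables that satisfy the canonical restrictions
and define a birational self-map of `ℙ^(n-1)`, that is, `k[F] ⊆ R^(d)` is birational. -/
structure IsCremonaSet (k : Type*) [Field k] {n : ℕ} (d : ℕ) (V : Fin n → (Fin n →₀ ℕ)) :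
    Prop where
  one_le : 1 ≤ d
  injective : Function.Injective V
  stochastic : IsStochastic d V
  canonical : CanonicalRestrictions V
  birational :
    IsBirationalExtension (Algebra.adjoin k (Set.range (monomials k V))) (veronese k n d)

/-! ### The inverse set -/

/-- The rational self-map of `ℙ^(n-1)` with coordinates `H` is the identity: `H` is proportional
to `(x_1, …, x_n)`, with a nonzero factor. -/
def IsProjectiveIdentity {k : Type*} [Field k] {n : ℕ} (H : Fin n → MvPolynomial (Fin n) k) :
    Prop :=
  ∃ h : MvPolynomial (Fin n) k, h ≠ 0 ∧ ∀ i, H i = h * X i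

/-- The coordinates of the composite `G ∘ F`: substitute the forms `F` for the variables
of the forms `G`. -/
def comp {k : Type*} [Field k] {n : ℕ} (G F : Fin n → MvPolynomial (Fin n) k) :
    Fin n → MvPolynomial (Fin n) k :=
  fun i => aeval F (G i)

/-- `W` is a Cremona inverse set of `V` over `k`: monomials of a common degree, satisfying the
canonical restrictions, that define the rational map inverse to the one defined by `V`. -/
structure IsInverseSet (k : Type*) [Field k] {n : ℕ} (V W : Fin n → (Fin n →₀ ℕ)) : Prop where
  stochastic : ∃ δ, 1 ≤ δ ∧ IsStochastic δ W
  canonical : CanonicalRestrictions W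
  left_inv : IsProjectiveIdentity (comp (monomials k W) (monomials k V))
  right_inv : IsProjectiveIdentity (comp (monomials k V) (monomials k W))

/-- The two sets of monomials coincide up to a permutation `π` of the variables (the source) and
a permutation `ρ` of the monomials (the target). -/
def EqUpToPermutation {n : ℕ} (V W : Fin n → (Fin n →₀ ℕ)) : Prop :=
  ∃ π ρ : Equiv.Perm (Fin n), ∀ i j, W (ρ j) (π i) = V j i

/-! ### The graph of a set of monomials of degree two -/

/-- The graph `G_F` of a set of monomials: its vertices are the variables, and the edge `j`
joins `u` and `v` when the `j`-th monomial is `x_u x_v`; a pure square is a loop. -/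
def monomialGraph {n : ℕ} (V : Fin n → (Fin n →₀ ℕ)) : Graph (Fin n) (Fin n) where
  vertexSet := Set.univ
  IsLink j u v := V j = Finsupp.single u 1 + Finsupp.single v 1
  isLink_symm := fun _ _ => ⟨fun _ _ h => h.trans (add_comm _ _)⟩
  eq_or_eq_of_isLink_of_isLink := by
    intro e x y v w h h'
    by_contra hne
    push Not at hne
    have := DFunLike.congr_fun (h.symm.trans h') x
    simp [Finsupp.single_apply, hne.1.symm, hne.2.symm] at this
  left_mem_of_isLink := fun _ _ _ _ => Set.mem_univ _

/-- The set of edges `K` is (the edge set of) a circuit of `G`: its `r ≥ 1` distinct edges join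
cyclically `r` distinct vertices. For `r = 1` this is a loop. -/
def IsCircuit {α β : Type*} (G : Graph α β) (K : Finset β) : Prop :=
  ∃ (m : ℕ) (vert : Fin (m + 1) → α) (edge : Fin (m + 1) → β),
    Function.Injective vert ∧ Function.Injective edge ∧
    (∀ i, G.IsLink (edge i) (vert i) (vert (i + 1))) ∧ (K : Set β) = Set.range edge

/-- The vertices on a set of edges. -/
def vertices {α β : Type*} (G : Graph α β) (K : Finset β) : Set α :=
  {x | ∃ e ∈ K, G.Inc e x}

/-- The degree of a vertex: the number of incident edges, loops counting twice. -/
def vertexDegree {α β : Type*} (G : Graph α β) (x : α) : ℕ :=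
  (G.incidenceSet x).ncard + (G.loopSet x).ncard

/-- The number `s` of vertices off `K` of degree at least two. -/
def numBranching {α β : Type*} (G : Graph α β) (K : Finset β) : ℕ :=
  {x | x ∈ G.vertexSet ∧ x ∉ vertices G K ∧ 2 ≤ vertexDegree G x}.ncard

/-- The vertices at distance at most `j` from the set `S`. -/
def ball {α β : Type*} (G : Graph α β) (S : Set α) : ℕ → Set α
  | 0 => S
  | j + 1 => ball G S j ∪ {v | ∃ u ∈ ball G S j, G.Adj u v}

/-- The number `s_j` (for `j ≥ 1`) of edges in the `j`-th neighborhood of `K`: the edges joining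
a vertex at distance `j - 1` from `K`, hence in the ball of radius `j - 1`, to a vertex at
distance `j`. -/
def neighborhoodSize {α β : Type*} (G : Graph α β) (K : Finset β) (j : ℕ) : ℕ :=
  {e | ∃ u ∈ ball G (vertices G K) (j - 1),
    ∃ v ∈ ball G (vertices G K) j \ ball G (vertices G K) (j - 1), G.IsLink e u v}.ncard

end MonomialCremona

end

/-!
Everything rests on the lattice spanned by the exponent vectors of `F`, that is, on the image of the
log-matrix `A` on integer vectors. Comparing supports in a fraction of elements of `k[F]` shows that
birationality puts all exponent vectors of degree two into this lattice
(`IsCremonaSet.exists_mulVec_eq`). Consequently `A` is injective, `A * c = e_i - e_j` has exactly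
one integer solution, and a linear form that is divisible by `d` on `F` is divisible by `d` on all
monomials of degree two (`IsCremonaSet.dvd_add`). With `d = 2` the last fact says that `G_F` is
connected (`IsCremonaSet.mem_of_closed`).

*Inverse.* The differences of the exponent vectors of an inverse are the solutions of
`A * c = e_i - e_j`, and the canonical restrictions fix the common translation. This gives
existence and uniqueness.

*Circuit.* If there were no circuit, `G_F` would be bipartite, and the sign of the colour would be
a linear form vanishing on `F` but not on `x_i ^ 2`. Alternating sums along a circuit show that its
edges are the odd coefficients in a solution of `A * c = 2 e_x`; modulo two this solution
does not depend on `x`, so the circuit is unique.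

*Equivalence.* If the inverse has degree two, the composite of `F` and its inverse is
`(γ x_1, …, γ x_n)` with a monomial `γ` of degree three, so each `γ x_i` is a product of two edges.
Going through the shapes `x^3`, `x^2 y`, `x y z` of `γ` leaves two normal forms (`TriangleForm`,
`LoopForm`): a triangle with leaves attached to it, or a loop at `x`, an edge `x y` and leaves
attached to `x` and `y`. These are also the graphs described by the numerical conditions. Conversely,
in a normal form there is an explicit bijection `E` from variables to monomials such
that renaming the variables by `E` turns `F` into its inverse (`isInverseSet_equivMapDomain`).
-/

namespace MonomialCremona

/-! ### The lattice of the exponent vectors -/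

/-- The log-matrix of the set of monomials: its `j`-th column is the exponent vector `V j`. -/
def logMatrix {n : ℕ} (V : Fin n → (Fin n →₀ ℕ)) : Matrix (Fin n) (Fin n) ℤ :=
  fun t j => V j t

open Matrix in
lemma logMatrix_mulVec_single {n : ℕ} (V : Fin n → (Fin n →₀ ℕ)) (j : Fin n) (z : ℤ) :
    logMatrix V *ᵥ Pi.single j z = fun t => (V j t : ℤ) * z := by
  ext t
  simp [logMatrix]

open Matrix in
/-- The exponents of the polynomials in `k[F]` lie in the lattice spanned by the exponents
of `F`. -/
lemma exists_mulVec_eq_of_mem_adjoin {k : Type*} [Field k] {n : ℕ} {V : Fin n → (Fin n →₀ ℕ)}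
    {p : MvPolynomial (Fin n) k} (hp : p ∈ Algebra.adjoin k (Set.range (monomials k V)))
    {m : Fin n →₀ ℕ} (hm : m ∈ p.support) :
    ∃ c : Fin n → ℤ, logMatrix V *ᵥ c = fun t => (m t : ℤ) := by
  classical
  induction hp using Algebra.adjoin_induction generalizing m with
  | mem x hx =>
    obtain ⟨j, rfl⟩ := hx
    have hmj : m = V j := by
      simpa using support_monomial_subset hm
    exact ⟨Pi.single j 1, by rw [logMatrix_mulVec_single, hmj]; simp⟩
  | algebraMap r =>
    have hm0 : m = 0 := by
      have := support_monomial_subset (s := 0) (a := r) hm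
      simpa using this
    exact ⟨0, by ext; simp [hm0]⟩
  | add x y _ _ hx hy =>
    rcases Finset.mem_union.1 (support_add hm) with h | h
    exacts [hx h, hy h]
  | mul x y _ _ hx hy =>
    obtain ⟨a, ha, b, hb, rfl⟩ := Finset.mem_add.1 (support_mul x y hm)
    obtain ⟨c, hc⟩ := hx ha
    obtain ⟨d, hd⟩ := hy hb
    exact ⟨c + d, by rw [mulVec_add, hc, hd]; ext; simp⟩

open Matrix in
/-- Birationality in terms of lattices: every monomial of degree `d` is a quotient of elements of
`k[F]`, and comparing supports shows that its exponent is an integer combination of the exponents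
of `F`. -/
lemma IsCremonaSet.exists_mulVec_eq {k : Type*} [Field k] {n d : ℕ} {V : Fin n → (Fin n →₀ ℕ)}
    (hV : IsCremonaSet k d V) {a : Fin n →₀ ℕ} (ha : a.degree = d) :
    ∃ c : Fin n → ℤ, logMatrix V *ᵥ c = fun t => (a t : ℤ) := by
  classical
  have hmem : algebraMap (MvPolynomial (Fin n) k) (FractionRing (MvPolynomial (Fin n) k))
      (monomial a 1) ∈ fractionSubfield (veronese k n d) :=
    IntermediateField.subset_adjoin _ _
      ⟨_, Algebra.subset_adjoin ⟨a, ha, rfl⟩, rfl⟩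
  rw [← hV.birational.2, fractionSubfield, IntermediateField.mem_adjoin_iff_div] at hmem
  have himage : ∀ r ∈ Algebra.adjoin k
      (algebraMap (MvPolynomial (Fin n) k) (FractionRing (MvPolynomial (Fin n) k)) ''
        (Algebra.adjoin k (Set.range (monomials k V)) : Subalgebra k _)),
      ∃ p ∈ Algebra.adjoin k (Set.range (monomials k V)), algebraMap _ _ p = r := by
    intro r hr
    have : algebraMap (MvPolynomial (Fin n) k) (FractionRing (MvPolynomial (Fin n) k)) ''
        (Algebra.adjoin k (Set.range (monomials k V)) : Subalgebra k _) =
        ((Algebra.adjoin k (Set.range (monomials k V))).map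
          (IsScalarTower.toAlgHom k (MvPolynomial (Fin n) k)
            (FractionRing (MvPolynomial (Fin n) k))) : Subalgebra k _) := rfl
    rw [this, Algebra.adjoin_eq] at hr
    exact hr
  obtain ⟨r, hr, s, hs, h⟩ := hmem
  obtain ⟨p, hp, rfl⟩ := himage r hr
  obtain ⟨q, hq, rfl⟩ := himage s hs
  have hq0 : q ≠ 0 := by
    rintro rfl
    rw [map_zero, div_zero, map_eq_zero_iff _ (IsFractionRing.injective _ _)] at h
    simp at h
  have hpq : monomial a 1 * q = p := by
    apply IsFractionRing.injective (MvPolynomial (Fin n) k)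
      (FractionRing (MvPolynomial (Fin n) k))
    rw [map_mul, h, div_mul_cancel₀]
    rwa [Ne, map_eq_zero_iff _ (IsFractionRing.injective _ _)]
  obtain ⟨m, hm⟩ := support_nonempty.2 hq0
  have ham : a + m ∈ p.support := by
    rw [← hpq, mem_support_iff, coeff_monomial_mul, one_mul]
    exact mem_support_iff.1 hm
  obtain ⟨c, hc⟩ := exists_mulVec_eq_of_mem_adjoin hp ham
  obtain ⟨e, he⟩ := exists_mulVec_eq_of_mem_adjoin hq hm
  exact ⟨c - e, by rw [mulVec_sub, hc, he]; ext; simp⟩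

section Lattice

variable {k : Type*} [Field k] {n : ℕ} {V : Fin n → (Fin n →₀ ℕ)}

open Matrix in
lemma IsCremonaSet.exists_mulVec_eq_single_add_single (hV : IsCremonaSet k 2 V) (u v : Fin n) :
    ∃ c : Fin n → ℤ, logMatrix V *ᵥ c = Pi.single u 1 + Pi.single v 1 := by
  obtain ⟨c, hc⟩ := hV.exists_mulVec_eq (a := Finsupp.single u 1 + Finsupp.single v 1) (by simp)
  refine ⟨c, hc.trans ?_⟩
  ext t
  simp [Finsupp.single_apply, Pi.single_apply, eq_comm]

open Matrix in
lemma IsCremonaSet.mulVec_injective (hV : IsCremonaSet k 2 V) :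
    Function.Injective (logMatrix V).mulVec := by
  choose c hc using fun u => hV.exists_mulVec_eq_single_add_single u u
  -- The columns `c u` form a matrix `C` with `A * C = 2`, so `A` has nonzero determinant.
  have hAC : logMatrix V * (Matrix.of c)ᵀ = (2 : ℤ) • (1 : Matrix (Fin n) (Fin n) ℤ) := by
    ext t u
    have := congrFun (hc u) t
    simp only [mulVec, dotProduct, Pi.add_apply] at this
    rw [mul_apply]
    simp only [transpose_apply, of_apply, this]
    simp only [Pi.single_apply, Matrix.smul_apply, one_apply]
    split_ifs <;> norm_num
  have hdet : (logMatrix V).det ≠ 0 := by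
    intro h0
    have := congrArg det hAC
    rw [det_mul, h0, zero_mul, det_smul, det_one] at this
    simp only [Fintype.card_fin, mul_one] at this
    exact pow_ne_zero n two_ne_zero this.symm
  intro x y hxy
  rw [← sub_eq_zero]
  apply eq_zero_of_mulVec_eq_zero hdet
  rw [mulVec_sub]
  exact sub_eq_zero.2 hxy

open Matrix in
/-- A linear form that is divisible by `d` on all exponent vectors is divisible by `d` on all
exponent vectors of degree two. -/
lemma IsCremonaSet.dvd_add (hV : IsCremonaSet k 2 V) {d : ℤ} {ψ : Fin n → ℤ}
    (hψ : ∀ j, d ∣ ∑ t, ψ t * V j t) (u v : Fin n) : d ∣ ψ u + ψ v := by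
  obtain ⟨c, hc⟩ := hV.exists_mulVec_eq_single_add_single u v
  have h := congrArg (ψ ⬝ᵥ ·) hc
  simp only [dotProduct_mulVec, dotProduct_add, dotProduct_single, mul_one] at h
  rw [← h]
  exact Finset.dvd_sum fun j _ => Dvd.dvd.mul_right (hψ j) _

lemma eq_single_add_single_of_degree_eq_two {α : Type*} {a : α →₀ ℕ} (ha : a.degree = 2) :
    ∃ u v, a = Finsupp.single u 1 + Finsupp.single v 1 := by
  classical
  have hcard : (Finsupp.toMultiset a).card = 2 := by
    rw [Finsupp.card_toMultiset, ← ha]; rfl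
  obtain ⟨u, v, huv⟩ := Multiset.card_eq_two.1 hcard
  refine ⟨u, v, ?_⟩
  rw [← Finsupp.toMultiset_toFinsupp a, huv, Multiset.insert_eq_cons,
    ← Multiset.singleton_add, map_add, Multiset.toFinsupp_singleton, Multiset.toFinsupp_singleton]

lemma IsCremonaSet.exists_eq (hV : IsCremonaSet k 2 V) (j : Fin n) :
    ∃ u v, V j = Finsupp.single u 1 + Finsupp.single v 1 :=
  eq_single_add_single_of_degree_eq_two (hV.stochastic j)

lemma sum_mul_single_add_single (ψ : Fin n → ℤ) (u v : Fin n) :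
    ∑ t, ψ t * ((Finsupp.single u 1 + Finsupp.single v 1 : Fin n →₀ ℕ) t : ℤ) = ψ u + ψ v := by
  simp [Finsupp.single_apply, mul_add, Finset.sum_add_distrib]

/-- Connectedness of `G_F`: the number of ends in `S` is even for every edge when no edge
leaves `S`, whereas it is odd for the monomial `x_u x_v` with `u` in `S` and `v` outside. -/
lemma IsCremonaSet.mem_of_closed (hV : IsCremonaSet k 2 V) {S : Set (Fin n)}
    (hS : ∀ j u v, V j = Finsupp.single u 1 + Finsupp.single v 1 → u ∈ S → v ∈ S)
    {u : Fin n} (hu : u ∈ S) (v : Fin n) : v ∈ S := by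
  classical
  by_contra hv
  have := hV.dvd_add (d := 2) (ψ := fun t => if t ∈ S then 1 else 0) (fun j => by
    obtain ⟨a, b, hab⟩ := hV.exists_eq j
    rw [hab, sum_mul_single_add_single]
    have h1 := hS j a b hab
    have h2 := hS j b a (hab.trans (add_comm _ _))
    by_cases ha : a ∈ S
    · simp [ha, h1 ha]
    · have hb : b ∉ S := fun h => ha (h2 h)
      simp [ha, hb]) u v
  simp [hu, hv] at this

end Lattice

/-! ### The inverse set -/

section Inverse

variable {k : Type*} [Field k] {n : ℕ} {V W : Fin n → (Fin n →₀ ℕ)}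

lemma comp_monomials (i : Fin n) :
    comp (monomials k W) (monomials k V) i = monomial (∑ j, W i j • V j) 1 := by
  simp only [comp, monomials, aeval_monomial, map_one, one_mul, monomial_pow, one_pow]
  rw [Finsupp.prod_fintype _ _ (by simp), monomial_sum_one]

lemma isProjectiveIdentity_comp_iff :
    IsProjectiveIdentity (comp (monomials k W) (monomials k V)) ↔
      ∃ γ : Fin n →₀ ℕ, ∀ i, ∑ j, W i j • V j = γ + Finsupp.single i 1 := by
  constructor
  · rintro ⟨h, h0, hh⟩
    obtain ⟨m, hm⟩ := support_nonempty.2 h0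
    refine ⟨m, fun i => ?_⟩
    have hi := congrArg (coeff (m + Finsupp.single i 1)) (hh i)
    rw [comp_monomials, coeff_mul_X, coeff_monomial] at hi
    by_contra hne
    rw [if_neg hne] at hi
    exact mem_support_iff.1 hm hi.symm
  · rintro ⟨γ, hγ⟩
    refine ⟨monomial γ 1, by simp, fun i => ?_⟩
    rw [comp_monomials, hγ, X, monomial_mul, one_mul]

open Matrix in
lemma logMatrix_mulVec_natCast (V : Fin n → (Fin n →₀ ℕ)) (b : Fin n →₀ ℕ) :
    logMatrix V *ᵥ (fun j => (b j : ℤ)) = fun t => (((∑ j, b j • V j : Fin n →₀ ℕ) t : ℕ) : ℤ) := by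
  ext t
  simp [mulVec, dotProduct, logMatrix, Finsupp.finsetSum_apply, mul_comm]

open Matrix in
/-- The differences `W i - W i'` are the unique solutions of `A * c = e_i - e_i'`, where `A` is
the log-matrix. -/
lemma IsInverseSet.mulVec_sub (h : IsInverseSet k V W) (i i' : Fin n) :
    logMatrix V *ᵥ (fun j => (W i j : ℤ) - W i' j) = Pi.single i 1 - Pi.single i' 1 := by
  obtain ⟨γ, hγ⟩ := isProjectiveIdentity_comp_iff.1 h.left_inv
  change logMatrix V *ᵥ ((fun j => (W i j : ℤ)) - fun j => (W i' j : ℤ)) = _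
  rw [Matrix.mulVec_sub, logMatrix_mulVec_natCast, logMatrix_mulVec_natCast, hγ, hγ]
  ext t
  simp [Finsupp.single_apply, Pi.single_apply, eq_comm]

lemma IsCremonaSet.inverseSet_unique (hV : IsCremonaSet k 2 V) {W' : Fin n → (Fin n →₀ ℕ)}
    (h : IsInverseSet k V W) (h' : IsInverseSet k V W') : W = W' := by
  have key : ∀ i i' j, (W i j : ℤ) - W i' j = W' i j - W' i' j := fun i i' j =>
    congrFun (hV.mulVec_injective ((h.mulVec_sub i i').trans (h'.mulVec_sub i i').symm)) j
  ext i j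
  -- Both columns `W · j` and `W' · j` differ by a constant and have minimum zero.
  obtain ⟨p, hp⟩ := h.canonical.1 j
  obtain ⟨q, hq⟩ := h'.canonical.1 j
  have h1 := key i p j
  have h2 := key i q j
  omega

open Matrix in
/-- The inverse set is obtained from the integer solutions `c i` of `A * c i = e_i - e_o` by adding
the same vector `β` to all of them, the least one that makes the exponents nonnegative. -/
lemma IsCremonaSet.exists_isInverseSet (hV : IsCremonaSet k 2 V) (hn : 2 ≤ n) :
    ∃ W, IsInverseSet k V W := by
  classical
  have : NeZero n := ⟨by omega⟩
  have hex : ∀ i : Fin n, ∃ c : Fin n → ℤ,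
      logMatrix V *ᵥ c = Pi.single i 1 - Pi.single 0 1 := by
    intro i
    obtain ⟨c, hc⟩ := hV.exists_mulVec_eq_single_add_single i 0
    obtain ⟨d, hd⟩ := hV.exists_mulVec_eq_single_add_single 0 0
    exact ⟨c - d, by rw [Matrix.mulVec_sub, hc, hd]; abel⟩
  choose c hc using hex
  have hmin : ∀ j, ∃ p, ∀ i, c p j ≤ c i j := fun j => Finite.exists_min fun i => c i j
  choose p hp using hmin
  set W : Fin n → (Fin n →₀ ℕ) := fun i =>
    Finsupp.equivFunOnFinite.symm fun j => (c i j - c (p j) j).toNat with hWdef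
  have hW : ∀ i j, (W i j : ℤ) = c i j - c (p j) j := fun i j => by
    simp only [hWdef, Finsupp.equivFunOnFinite_symm_apply_apply]
    exact Int.toNat_of_nonneg (sub_nonneg.2 (hp j i))
  have hWsub : ∀ i, logMatrix V *ᵥ (fun j => (W i j : ℤ)) =
      Pi.single i 1 - Pi.single 0 1 - logMatrix V *ᵥ (fun j => c (p j) j) := by
    intro i
    rw [← hc i, ← Matrix.mulVec_sub]
    congr 1
    ext j
    exact hW i j
  -- An integer vector `g` with `g + e_i ≥ 0` for all `i` is nonnegative, as `n ≥ 2`.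
  have hnonneg : ∀ (a : Fin n → (Fin n →₀ ℕ)) (g : Fin n → ℤ),
      (∀ i t, (a i t : ℤ) = g t + (Pi.single i 1 : Fin n → ℤ) t) →
      ∃ γ : Fin n →₀ ℕ, ∀ i, a i = γ + Finsupp.single i 1 := by
    intro a g hag
    refine ⟨Finsupp.equivFunOnFinite.symm fun t => (g t).toNat, fun i => ?_⟩
    ext t
    have hgt : 0 ≤ g t := by
      have : Nontrivial (Fin n) := Fin.nontrivial_iff_two_le.2 hn
      obtain ⟨i', hi'⟩ := exists_ne t
      have := hag i' t
      rw [Pi.single_eq_of_ne hi'.symm] at this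
      omega
    have := hag i t
    simp only [Finsupp.add_apply, Finsupp.equivFunOnFinite_symm_apply_apply,
      Finsupp.single_apply, Pi.single_apply] at this ⊢
    by_cases hit : i = t
    · simp only [hit, if_true] at this ⊢; omega
    · simp only [hit, Ne.symm hit, if_false] at this ⊢; omega
  have hleft : ∃ γ : Fin n →₀ ℕ, ∀ i, ∑ j, W i j • V j = γ + Finsupp.single i 1 := by
    refine hnonneg _ (fun t => -(Pi.single 0 1 : Fin n → ℤ) t -
      (logMatrix V *ᵥ (fun j => c (p j) j)) t) fun i t => ?_
    have := congrFun (hWsub i) t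
    rw [logMatrix_mulVec_natCast] at this
    simp only [Pi.sub_apply] at this
    rw [this]
    ring
  have hright : ∃ γ : Fin n →₀ ℕ, ∀ j, ∑ i, V j i • W i = γ + Finsupp.single j 1 := by
    obtain ⟨d, hd⟩ := hV.exists_mulVec_eq_single_add_single 0 0
    -- It suffices to compare the images under the log-matrix, which is injective.
    refine hnonneg _ (fun t => -d t - 2 * c (p t) t) fun j t => ?_
    refine congrFun (f := fun t => (((∑ i, V j i • W i : Fin n →₀ ℕ) t : ℕ) : ℤ))
      (g := fun t => -d t - 2 * c (p t) t + (Pi.single j 1 : Fin n → ℤ) t)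
      (hV.mulVec_injective ?_) t
    have h1 : (fun t => (((∑ i, V j i • W i : Fin n →₀ ℕ) t : ℕ) : ℤ)) =
        ∑ i, (V j i : ℤ) • (fun t => (W i t : ℤ)) := by
      ext t
      simp [Finsupp.finsetSum_apply]
    have h2 : (fun t => -d t - 2 * c (p t) t + (Pi.single j 1 : Fin n → ℤ) t) =
        -d - (2 : ℤ) • (fun t => c (p t) t) + Pi.single j 1 := by
      ext t
      simp
    have hdeg : ∑ i, (V j i : ℤ) = 2 := by
      have := hV.stochastic j
      rw [Finsupp.degree_eq_sum] at this
      exact_mod_cast this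
    have h3 : ∑ i, (V j i : ℤ) • (Pi.single i 1 : Fin n → ℤ) = fun t => (V j t : ℤ) := by
      ext t
      simp [Finset.sum_apply, Pi.single_apply]
    rw [h1, h2, Matrix.mulVec_sum, mulVec_add, Matrix.mulVec_sub, mulVec_neg, hd, mulVec_smul,
      logMatrix_mulVec_single]
    simp only [mulVec_smul, hWsub, smul_sub, Finset.sum_sub_distrib, h3, ← Finset.sum_smul, hdeg]
    ext t
    simp
    ring
  have hcol : ∀ j, ∃ i, W i j = 0 := fun j => ⟨p j, by
    have := hW (p j) j
    omega⟩
  -- The variable `j` occurs in the `j`-th coordinate of `V ∘ W`, hence in some monomial of `W`.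
  have hvar : ∀ j, ∃ i, W i j ≠ 0 := by
    obtain ⟨γ, hγ⟩ := hright
    intro j
    by_contra! hall
    have := DFunLike.congr_fun (hγ j) j
    simp [Finsupp.finsetSum_apply, hall] at this
  refine ⟨W, ⟨?_, ⟨hcol, hvar⟩, isProjectiveIdentity_comp_iff.2 hleft,
    isProjectiveIdentity_comp_iff.2 hright⟩⟩
  -- Counting degrees in `W i ∘ V` gives `2 * deg (W i) = deg γ + 1`.
  obtain ⟨γ, hγ⟩ := hleft
  have hdeg : ∀ i, (W i).degree * 2 = γ.degree + 1 := by
    intro i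
    have := congrArg Finsupp.degree (hγ i)
    rw [map_sum, map_add, Finsupp.degree_single] at this
    rw [← this, Finsupp.degree_eq_sum, Finset.sum_mul]
    refine Finset.sum_congr rfl fun j _ => ?_
    rw [map_nsmul, hV.stochastic j, smul_eq_mul]
  refine ⟨(γ.degree + 1) / 2, ?_, fun i => ?_⟩
  · have := hdeg 0
    omega
  · have := hdeg i
    omega

/-- Suppose that the bijection `E` between variables and monomials satisfies
`∏_s x^(V (E s))^(V (E i) s) = x^γ * x_i`. Then renaming each variable by `E` turns the monomials
of `V` into those of an inverse of `V`. -/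
lemma isInverseSet_equivMapDomain (hV : IsCremonaSet k 2 V) (E : Equiv.Perm (Fin n))
    {γ : Fin n →₀ ℕ} (h : ∀ i, ∑ s, V (E i) s • V (E s) = γ + Finsupp.single i 1) :
    IsInverseSet k V fun i => (V (E i)).equivMapDomain E where
  stochastic := ⟨2, by norm_num, fun i => by
    have := hV.stochastic (E i)
    rw [Finsupp.degree_eq_sum] at this ⊢
    rw [← this]
    simp only [Finsupp.equivMapDomain_apply]
    exact Equiv.sum_comp E.symm fun s => V (E i) s⟩
  canonical := by
    refine ⟨fun j => ?_, fun j => ?_⟩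
    · obtain ⟨i, hi⟩ := hV.canonical.1 (E.symm j)
      exact ⟨E.symm i, by simpa using hi⟩
    · obtain ⟨i, hi⟩ := hV.canonical.2 (E.symm j)
      exact ⟨E.symm i, by simpa using hi⟩
  left_inv := isProjectiveIdentity_comp_iff.2 ⟨γ, fun i => by
    rw [← h i, ← Equiv.sum_comp E]
    simp⟩
  right_inv := isProjectiveIdentity_comp_iff.2 ⟨γ.equivMapDomain E, fun j => by
    ext t
    have := DFunLike.congr_fun (h (E.symm j)) (E.symm t)
    simpa [Finsupp.finsetSum_apply, Finsupp.single_apply] using this⟩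

/-- In the situation of `isInverseSet_equivMapDomain` the set is a `p`-involution. -/
lemma eqUpToPermutation_of_perm (hV : IsCremonaSet k 2 V) (hW : IsInverseSet k V W)
    (E : Equiv.Perm (Fin n)) {γ : Fin n →₀ ℕ}
    (h : ∀ i, ∑ s, V (E i) s • V (E s) = γ + Finsupp.single i 1) : EqUpToPermutation V W := by
  rw [hV.inverseSet_unique hW (isInverseSet_equivMapDomain hV E h)]
  exact ⟨E, E.symm, fun i j => by simp⟩

lemma EqUpToPermutation.isStochastic {d : ℕ} (h : EqUpToPermutation V W) (hV : IsStochastic d V) :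
    IsStochastic d W := by
  obtain ⟨π, ρ, hπρ⟩ := h
  intro j
  rw [← hV (ρ.symm j), Finsupp.degree_eq_sum, Finsupp.degree_eq_sum, ← Equiv.sum_comp π]
  refine Finset.sum_congr rfl fun i _ => ?_
  rw [← hπρ, Equiv.apply_symm_apply]

end Inverse

/-! ### The circuit -/

section Circuit

variable {k : Type*} [Field k] {n : ℕ} {V : Fin n → (Fin n →₀ ℕ)}

lemma sum_neg_one_pow_smul_add {M : Type*} [AddCommGroup M] {m : ℕ} (f : Fin (m + 1) → M) :
    ∑ i : Fin (m + 1), (-1 : ℤ) ^ (i : ℕ) • (f i + f (i + 1)) = (1 + (-1 : ℤ) ^ m) • f 0 := by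
  simp only [smul_add, Finset.sum_add_distrib]
  rw [Fin.sum_univ_succ,
    Fin.sum_univ_castSucc (fun i : Fin (m + 1) => (-1 : ℤ) ^ (i : ℕ) • f (i + 1))]
  simp only [Fin.val_succ, Fin.val_castSucc, Fin.coeSucc_eq_succ, Fin.last_add_one, Fin.val_last,
    Fin.val_zero, pow_zero, one_smul, pow_succ, mul_neg, mul_one, neg_smul,
    Finset.sum_neg_distrib, add_smul]
  abel

open Matrix in
/-- The alternating sum of the exponent vectors along a circuit is `2 e_x` (and a circuit of even
length would make it zero), so the circuit is the set of odd coefficients of a solution of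
`A * c = 2 e_x`. -/
lemma IsCremonaSet.exists_mulVec_eq_of_isCircuit (hV : IsCremonaSet k 2 V) {K : Finset (Fin n)}
    (hK : IsCircuit (monomialGraph V) K) :
    ∃ (c : Fin n → ℤ) (x : Fin n), logMatrix V *ᵥ c = Pi.single x 1 + Pi.single x 1 ∧
      ∀ j, j ∈ K ↔ Odd (c j) := by
  classical
  obtain ⟨m, vert, edge, -, hedge, hlink, hKe⟩ := hK
  set c : Fin n → ℤ := ∑ i : Fin (m + 1), Pi.single (edge i) ((-1 : ℤ) ^ (i : ℕ)) with hc
  have hcK : ∀ i, c (edge i) = (-1) ^ (i : ℕ) := by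
    intro i
    rw [hc, Finset.sum_apply, Finset.sum_eq_single i, Pi.single_eq_same]
    · exact fun i' _ h => Pi.single_eq_of_ne (fun h' => h (hedge h').symm) _
    · simp
  have hodd : ∀ j, j ∈ K ↔ Odd (c j) := by
    intro j
    have hj : j ∈ K ↔ j ∈ Set.range edge := by rw [← hKe, Finset.mem_coe]
    rw [hj]
    constructor
    · rintro ⟨i, rfl⟩
      rw [hcK]
      exact Odd.pow (by decide)
    · intro h
      by_contra hne
      have : c j = 0 := by
        rw [hc, Finset.sum_apply]
        exact Finset.sum_eq_zero fun i _ => Pi.single_eq_of_ne (fun h' => hne ⟨i, h'.symm⟩) _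
      rw [this] at h
      exact absurd h (by decide)
  have hAc : logMatrix V *ᵥ c = (1 + (-1 : ℤ) ^ m) • (Pi.single (vert 0) 1 : Fin n → ℤ) := by
    rw [← sum_neg_one_pow_smul_add fun i => (Pi.single (vert i) 1 : Fin n → ℤ), hc,
      Matrix.mulVec_sum]
    refine Finset.sum_congr rfl fun i _ => ?_
    have hi : V (edge i) = Finsupp.single (vert i) 1 + Finsupp.single (vert (i + 1)) 1 := hlink i
    rw [logMatrix_mulVec_single, hi]
    ext t
    simp [Finsupp.single_apply, Pi.single_apply, mul_comm, eq_comm]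
  refine ⟨c, vert 0, ?_, hodd⟩
  rcases Nat.even_or_odd m with hm | hm
  · rw [hAc, hm.neg_one_pow, ← one_smul ℤ (Pi.single (vert 0) 1 + Pi.single (vert 0) 1), smul_add,
      ← add_smul]
  · rw [hm.neg_one_pow, add_neg_cancel, zero_smul] at hAc
    have h0 : c = 0 := hV.mulVec_injective (hAc.trans (mulVec_zero _).symm)
    have := hcK 0
    simp [h0] at this

/-- Solutions of `A * c = 2 e_x` for different `x` differ by twice an integer vector, so the set
of their odd coefficients, and with it the circuit, is determined. -/
lemma IsCremonaSet.circuit_unique (hV : IsCremonaSet k 2 V) {K K' : Finset (Fin n)}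
    (hK : IsCircuit (monomialGraph V) K) (hK' : IsCircuit (monomialGraph V) K') : K = K' := by
  obtain ⟨c, x, hc, hcK⟩ := hV.exists_mulVec_eq_of_isCircuit hK
  obtain ⟨c', x', hc', hcK'⟩ := hV.exists_mulVec_eq_of_isCircuit hK'
  obtain ⟨d, hd⟩ := hV.exists_mulVec_eq_single_add_single x x'
  have h : c + c' = d + d := hV.mulVec_injective (by
    simp only [Matrix.mulVec_add, hc, hc', hd]
    abel)
  ext j
  have hj := congrFun h j
  simp only [Pi.add_apply] at hj
  rw [hcK, hcK', ← Int.not_even_iff_odd, ← Int.not_even_iff_odd, not_iff_not, ← Int.even_add, hj]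
  exact ⟨d j, rfl⟩

lemma isCircuit_singleton {x j : Fin n}
    (h : V j = Finsupp.single x 1 + Finsupp.single x 1) : IsCircuit (monomialGraph V) {j} :=
  ⟨0, fun _ => x, fun _ => j, fun a b _ => Subsingleton.elim (α := Fin 1) a b,
    fun a b _ => Subsingleton.elim (α := Fin 1) a b, fun _ => h, by simp⟩

/-- The simple graph underlying the graph of a set of monomials: pure squares are dropped. -/
def simpleGraph (V : Fin n → (Fin n →₀ ℕ)) : SimpleGraph (Fin n) where
  Adj u v := u ≠ v ∧ ∃ j, V j = Finsupp.single u 1 + Finsupp.single v 1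
  symm := ⟨fun _ _ h => ⟨h.1.symm, h.2.imp fun _ hj => hj.trans (add_comm _ _)⟩⟩
  loopless := ⟨fun _ h => h.1 rfl⟩

lemma exists_isCircuit_of_isCycle {u : Fin n} {p : (simpleGraph V).Walk u u} (hp : p.IsCycle) :
    ∃ K, IsCircuit (monomialGraph V) K := by
  obtain ⟨m, hm⟩ : ∃ m, p.length = m + 1 := ⟨p.length - 1, by have := hp.three_le_length; omega⟩
  have hm2 : 2 ≤ m := by have := hp.three_le_length; omega
  set vert : Fin (m + 1) → Fin n := fun i => p.getVert i with hvert
  have hinj : Function.Injective vert := fun i i' h =>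
    Fin.ext (hp.getVert_injOn' (show (i : ℕ) ≤ p.length - 1 by omega)
      (show (i' : ℕ) ≤ p.length - 1 by omega) h)
  have hadj : ∀ i : Fin (m + 1), (simpleGraph V).Adj (vert i) (vert (i + 1)) := by
    intro i
    have h := p.adj_getVert_succ (i := i) (by omega)
    have hv : vert (i + 1) = p.getVert (i + 1) := by
      rcases Fin.eq_castSucc_or_eq_last i with ⟨i', rfl⟩ | rfl
      · rw [Fin.coeSucc_eq_succ]
        rfl
      · rw [Fin.last_add_one, Fin.val_last, p.getVert_of_length_le hm.le]
        exact p.getVert_zero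
    rwa [hv]
  choose edge hedge using fun i => (hadj i).2
  classical
  refine ⟨Finset.univ.image edge, m, vert, edge, hinj, fun i i' h => ?_, hedge, by simp⟩
  have hlink : (monomialGraph V).IsLink (edge i) (vert i') (vert (i' + 1)) := h ▸ hedge i'
  rcases Graph.IsLink.eq_and_eq_or_eq_and_eq (hedge i) hlink with h | h
  · exact hinj h.1
  · -- Here `i = i' + 1` and `i + 1 = i'`, impossible in a circuit of length at least three.
    have h1 := hinj h.1
    have h2 := hinj h.2
    rw [h1, add_assoc, add_eq_left] at h2
    have := congrArg Fin.val h2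
    rw [Fin.val_add, Fin.val_one', Fin.val_zero, Nat.mod_eq_of_lt (show 1 < m + 1 by omega),
      Nat.mod_eq_of_lt (by omega)] at this
    omega

/-- Without a circuit the graph would be bipartite, and the sign of the colour would be a linear
form that vanishes on all exponent vectors but not on `2 e_x`. -/
lemma IsCremonaSet.exists_isCircuit (hV : IsCremonaSet k 2 V) (hn : 2 ≤ n) :
    ∃ K, IsCircuit (monomialGraph V) K := by
  by_contra hno
  have hac : (simpleGraph V).IsAcyclic := fun u p hp => hno (exists_isCircuit_of_isCycle hp)
  obtain ⟨C⟩ := hac.isBipartite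
  have hψ : ∀ j, (0 : ℤ) ∣ ∑ t, (if C t = 0 then (1 : ℤ) else -1) * V j t := by
    intro j
    obtain ⟨u, v, huv⟩ := hV.exists_eq j
    rw [huv, sum_mul_single_add_single]
    have hne : u ≠ v := by
      rintro rfl
      exact hno ⟨_, isCircuit_singleton huv⟩
    have hC : C u ≠ C v := C.valid ⟨hne, j, huv⟩
    generalize C u = a at hC
    generalize C v = b at hC
    fin_cases a <;> fin_cases b <;> simp at hC ⊢
  have := hV.dvd_add hψ ⟨0, by omega⟩ ⟨0, by omega⟩
  split_ifs at this <;> norm_num at this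

end Circuit

/-! ### Normal forms of the quadratic `p`-involutions -/

section NormalForms

variable {k : Type*} [Field k] {n : ℕ} {V W : Fin n → (Fin n →₀ ℕ)}

/-- `G_F` consists of a loop at `x`, an edge `x y`, and further leaves attached to `x` or `y`.
The permutation `E` records the edges: `E i` is the edge of the leaf `i`, while the
edge `x y` is `E x` and the loop is `E y`. -/
structure LoopForm (V : Fin n → (Fin n →₀ ℕ)) (x y : Fin n) (E : Equiv.Perm (Fin n)) : Prop where
  ne : x ≠ y
  edge : V (E x) = Finsupp.single x 1 + Finsupp.single y 1
  loop : V (E y) = Finsupp.single x 1 + Finsupp.single x 1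
  leaf : ∀ i, i ≠ x → i ≠ y → V (E i) = Finsupp.single x 1 + Finsupp.single i 1 ∨
    V (E i) = Finsupp.single y 1 + Finsupp.single i 1

/-- `G_F` consists of a triangle `a b c` and leaves attached to it. The permutation `E` records
the edges: `E i` is the edge of the leaf `i`, and `E a`, `E b`, `E c` are the edges of the triangle
opposite to `a`, `b`, `c`. -/
structure TriangleForm (V : Fin n → (Fin n →₀ ℕ)) (a b c : Fin n) (E : Equiv.Perm (Fin n)) :
    Prop where
  ne_ab : a ≠ b
  ne_ac : a ≠ c
  ne_bc : b ≠ c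
  edge_a : V (E a) = Finsupp.single b 1 + Finsupp.single c 1
  edge_b : V (E b) = Finsupp.single a 1 + Finsupp.single c 1
  edge_c : V (E c) = Finsupp.single a 1 + Finsupp.single b 1
  leaf : ∀ i, i ≠ a → i ≠ b → i ≠ c → V (E i) = Finsupp.single a 1 + Finsupp.single i 1 ∨
    V (E i) = Finsupp.single b 1 + Finsupp.single i 1 ∨
    V (E i) = Finsupp.single c 1 + Finsupp.single i 1

lemma single_add_single_inj {α : Type*} {a b c d : α}
    (h : (Finsupp.single a 1 + Finsupp.single b 1 : α →₀ ℕ) =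
      Finsupp.single c 1 + Finsupp.single d 1) : (a = c ∧ b = d) ∨ (a = d ∧ b = c) := by
  classical
  have ha := DFunLike.congr_fun h a
  have hb := DFunLike.congr_fun h b
  have hc := DFunLike.congr_fun h c
  have hd := DFunLike.congr_fun h d
  simp only [Finsupp.add_apply, Finsupp.single_apply] at ha hb hc hd
  grind

lemma sum_single_add_single_smul (f : Fin n → (Fin n →₀ ℕ)) (u v : Fin n) :
    ∑ s, (Finsupp.single u 1 + Finsupp.single v 1 : Fin n →₀ ℕ) s • f s = f u + f v := by
  simp [Finsupp.single_apply, add_smul, Finset.sum_add_distrib]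

lemma exists_perm_of_injective {Q : Fin n → Fin n → Prop} (hex : ∀ i, ∃ j, Q i j)
    (hinj : ∀ i i' j, Q i j → Q i' j → i = i') : ∃ E : Equiv.Perm (Fin n), ∀ i, Q i (E i) := by
  choose f hf using hex
  have hf' : Function.Injective f := fun i i' h => hinj i i' (f i) (hf i) (h ▸ hf i')
  exact ⟨Equiv.ofBijective f (Finite.injective_iff_bijective.1 hf'), hf⟩

lemma exists_loopForm {x y : Fin n} (hxy : x ≠ y) (hxx : (monomialGraph V).Adj x x)
    (h : (monomialGraph V).Adj x y)
    (hleaf : ∀ i, i ≠ x → i ≠ y → (monomialGraph V).Adj x i ∨ (monomialGraph V).Adj y i) :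
    ∃ E, LoopForm V x y E := by
  obtain ⟨E, hE⟩ := exists_perm_of_injective
    (Q := fun i j => (i = x → V j = Finsupp.single x 1 + Finsupp.single y 1) ∧
      (i = y → V j = Finsupp.single x 1 + Finsupp.single x 1) ∧
      (i ≠ x → i ≠ y → V j = Finsupp.single x 1 + Finsupp.single i 1 ∨
        V j = Finsupp.single y 1 + Finsupp.single i 1)) (fun i => by
      by_cases hix : i = x
      · subst hix
        obtain ⟨j, hj⟩ := h
        exact ⟨j, fun _ => hj, fun h => absurd h hxy, fun h => absurd rfl h⟩
      by_cases hiy : i = y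
      · subst hiy
        obtain ⟨j, hj⟩ := hxx
        exact ⟨j, fun h => absurd h hix, fun _ => hj, fun _ h => absurd rfl h⟩
      rcases hleaf i hix hiy with ⟨j, hj⟩ | ⟨j, hj⟩
      · exact ⟨j, fun h => absurd h hix, fun h => absurd h hiy, fun _ _ => Or.inl hj⟩
      · exact ⟨j, fun h => absurd h hix, fun h => absurd h hiy, fun _ _ => Or.inr hj⟩)
    (fun i i' j hi hi' => by
      have key := fun a b c d (h : V j = _) (h' : V j = _) =>
        single_add_single_inj (a := a) (b := b) (c := c) (d := d) (h.symm.trans h')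
      grind)
  exact ⟨E, hxy, (hE x).1 rfl, (hE y).2.1 rfl, fun i => (hE i).2.2⟩

lemma exists_triangleForm {a b c : Fin n} (hab : a ≠ b) (hac : a ≠ c) (hbc : b ≠ c)
    (h_ab : (monomialGraph V).Adj a b) (h_ac : (monomialGraph V).Adj a c)
    (h_bc : (monomialGraph V).Adj b c)
    (hleaf : ∀ i, i ≠ a → i ≠ b → i ≠ c → (monomialGraph V).Adj a i ∨
      (monomialGraph V).Adj b i ∨ (monomialGraph V).Adj c i) :
    ∃ E, TriangleForm V a b c E := by
  obtain ⟨E, hE⟩ := exists_perm_of_injective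
    (Q := fun i j => (i = a → V j = Finsupp.single b 1 + Finsupp.single c 1) ∧
      (i = b → V j = Finsupp.single a 1 + Finsupp.single c 1) ∧
      (i = c → V j = Finsupp.single a 1 + Finsupp.single b 1) ∧
      (i ≠ a → i ≠ b → i ≠ c → V j = Finsupp.single a 1 + Finsupp.single i 1 ∨
        V j = Finsupp.single b 1 + Finsupp.single i 1 ∨
        V j = Finsupp.single c 1 + Finsupp.single i 1)) (fun i => by
      by_cases hia : i = a
      · obtain ⟨j, hj⟩ := h_bc
        have hj : V j = _ := hj
        exact ⟨j, by grind⟩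
      by_cases hib : i = b
      · obtain ⟨j, hj⟩ := h_ac
        have hj : V j = _ := hj
        exact ⟨j, by grind⟩
      by_cases hic : i = c
      · obtain ⟨j, hj⟩ := h_ab
        have hj : V j = _ := hj
        exact ⟨j, by grind⟩
      rcases hleaf i hia hib hic with ⟨j, hj⟩ | ⟨j, hj⟩ | ⟨j, hj⟩
      all_goals
        have hj : V j = _ := hj
        exact ⟨j, by grind⟩)
    (fun i i' j hi hi' => by
      have key := fun a b c d (h : V j = _) (h' : V j = _) =>
        single_add_single_inj (a := a) (b := b) (c := c) (d := d) (h.symm.trans h')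
      grind)
  exact ⟨E, hab, hac, hbc, (hE a).1 rfl, (hE b).2.1 rfl, (hE c).2.2.1 rfl, fun i => (hE i).2.2.2⟩

/-! ### Normal forms are `p`-involutions -/

lemma LoopForm.eqUpToPermutation {x y : Fin n} {E : Equiv.Perm (Fin n)} (h : LoopForm V x y E)
    (hV : IsCremonaSet k 2 V) (hW : IsInverseSet k V W) : EqUpToPermutation V W := by
  refine eqUpToPermutation_of_perm hV hW E
    (γ := Finsupp.single x 1 + Finsupp.single x 1 + Finsupp.single y 1) fun i => ?_
  by_cases hix : i = x
  · rw [hix, h.edge, sum_single_add_single_smul, h.edge, h.loop]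
    abel
  by_cases hiy : i = y
  · rw [hiy, h.loop, sum_single_add_single_smul, h.edge]
    abel
  rcases h.leaf i hix hiy with hi | hi
  · rw [hi, sum_single_add_single_smul, h.edge, hi]
    abel
  · rw [hi, sum_single_add_single_smul, h.loop, hi]
    abel

lemma TriangleForm.eqUpToPermutation {a b c : Fin n} {E : Equiv.Perm (Fin n)}
    (h : TriangleForm V a b c E) (hV : IsCremonaSet k 2 V) (hW : IsInverseSet k V W) :
    EqUpToPermutation V W := by
  refine eqUpToPermutation_of_perm hV hW E
    (γ := Finsupp.single a 1 + Finsupp.single b 1 + Finsupp.single c 1) fun i => ?_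
  by_cases hia : i = a
  · rw [hia, h.edge_a, sum_single_add_single_smul, h.edge_b, h.edge_c]
    abel
  by_cases hib : i = b
  · rw [hib, h.edge_b, sum_single_add_single_smul, h.edge_a, h.edge_c]
    abel
  by_cases hic : i = c
  · rw [hic, h.edge_c, sum_single_add_single_smul, h.edge_a, h.edge_b]
    abel
  rcases h.leaf i hia hib hic with hi | hi | hi
  · rw [hi, sum_single_add_single_smul, h.edge_a, hi]
    abel
  · rw [hi, sum_single_add_single_smul, h.edge_b, hi]
    abel
  · rw [hi, sum_single_add_single_smul, h.edge_c, hi]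
    abel

/-! ### An inverse of degree two forces a normal form -/

lemma eq_single_add_single_add_single_of_degree_eq_three {α : Type*} {a : α →₀ ℕ}
    (ha : a.degree = 3) :
    ∃ p q r, a = Finsupp.single p 1 + Finsupp.single q 1 + Finsupp.single r 1 := by
  classical
  have hcard : (Finsupp.toMultiset a).card = 3 := by
    rw [Finsupp.card_toMultiset, ← ha]; rfl
  obtain ⟨p, q, r, h⟩ := Multiset.card_eq_three.1 hcard
  refine ⟨p, q, r, ?_⟩
  rw [← Finsupp.toMultiset_toFinsupp a, h, Multiset.insert_eq_cons, Multiset.insert_eq_cons,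
    ← Multiset.singleton_add, ← Multiset.singleton_add, map_add, map_add,
    Multiset.toFinsupp_singleton, Multiset.toFinsupp_singleton, Multiset.toFinsupp_singleton,
    add_assoc]

lemma single_add_eq_three {α : Type*} {v q r s : α} {a : α →₀ ℕ}
    (h : Finsupp.single v 1 + a =
      Finsupp.single q 1 + Finsupp.single r 1 + Finsupp.single s 1) :
    (v = q ∧ a = Finsupp.single r 1 + Finsupp.single s 1) ∨
    (v = r ∧ a = Finsupp.single q 1 + Finsupp.single s 1) ∨
    (v = s ∧ a = Finsupp.single q 1 + Finsupp.single r 1) := by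
  classical
  have hv : v = q ∨ v = r ∨ v = s := by
    have := DFunLike.congr_fun h v
    simp only [Finsupp.add_apply, Finsupp.single_apply] at this
    grind
  rcases hv with rfl | rfl | rfl
  · exact Or.inl ⟨rfl, add_left_cancel (h.trans (by abel))⟩
  · exact Or.inr (Or.inl ⟨rfl, add_left_cancel (h.trans (by abel))⟩)
  · exact Or.inr (Or.inr ⟨rfl, add_left_cancel (h.trans (by abel))⟩)

lemma single_add_eq_four {α : Type*} {u p q r s : α} {a : α →₀ ℕ}
    (h : Finsupp.single u 1 + a =
      Finsupp.single p 1 + Finsupp.single q 1 + Finsupp.single r 1 + Finsupp.single s 1) :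
    (u = p ∧ a = Finsupp.single q 1 + Finsupp.single r 1 + Finsupp.single s 1) ∨
    (u = q ∧ a = Finsupp.single p 1 + Finsupp.single r 1 + Finsupp.single s 1) ∨
    (u = r ∧ a = Finsupp.single p 1 + Finsupp.single q 1 + Finsupp.single s 1) ∨
    (u = s ∧ a = Finsupp.single p 1 + Finsupp.single q 1 + Finsupp.single r 1) := by
  classical
  have hu : u = p ∨ u = q ∨ u = r ∨ u = s := by
    have := DFunLike.congr_fun h u
    simp only [Finsupp.add_apply, Finsupp.single_apply] at this
    grind
  rcases hu with rfl | rfl | rfl | rfl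
  · exact Or.inl ⟨rfl, add_left_cancel (h.trans (by abel))⟩
  · exact Or.inr (Or.inl ⟨rfl, add_left_cancel (h.trans (by abel))⟩)
  · exact Or.inr (Or.inr (Or.inl ⟨rfl, add_left_cancel (h.trans (by abel))⟩))
  · exact Or.inr (Or.inr (Or.inr ⟨rfl, add_left_cancel (h.trans (by abel))⟩))

/-- The three ways to write a monomial of degree four as a product of two quadratic monomials. -/
lemma pairing_of_add_eq {α : Type*} {P : α → α → Prop} (symm : ∀ {u v}, P u v → P v u)
    {a b : α →₀ ℕ} {p q r s : α} (ha : a.degree = 2)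
    (hPa : ∀ {u v}, a = Finsupp.single u 1 + Finsupp.single v 1 → P u v)
    (hPb : ∀ {u v}, b = Finsupp.single u 1 + Finsupp.single v 1 → P u v)
    (h : a + b = Finsupp.single p 1 + Finsupp.single q 1 + Finsupp.single r 1 +
      Finsupp.single s 1) :
    (P p q ∧ P r s) ∨ (P p r ∧ P q s) ∨ (P p s ∧ P q r) := by
  obtain ⟨u, v, huv⟩ := eq_single_add_single_of_degree_eq_two ha
  have h1 := hPa huv
  have h1' := symm h1
  rw [huv, add_assoc] at h
  have h2 : ∀ {c d}, b = Finsupp.single c 1 + Finsupp.single d 1 → P c d ∧ P d c :=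
    fun h => ⟨hPb h, symm (hPb h)⟩
  rcases single_add_eq_four h with ⟨hu, h⟩ | ⟨hu, h⟩ | ⟨hu, h⟩ | ⟨hu, h⟩ <;>
  rcases single_add_eq_three h with ⟨hv, h⟩ | ⟨hv, h⟩ | ⟨hv, h⟩ <;>
  · rw [hu, hv] at h1 h1'
    simp only [h1, h1', h2 h, and_self, true_or, or_true]

/-- If the inverse has degree two, then its composite with `F` is given by a cubic monomial
`x_p x_q x_r` all of whose multiples by a variable are products of two edges. -/
lemma IsCremonaSet.exists_cubic (hV : IsCremonaSet k 2 V) (hn : 2 ≤ n) (hW : IsInverseSet k V W)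
    (hW2 : IsStochastic 2 W) : ∃ p q r : Fin n, ∀ i,
    ((monomialGraph V).Adj p q ∧ (monomialGraph V).Adj r i) ∨
    ((monomialGraph V).Adj p r ∧ (monomialGraph V).Adj q i) ∨
    ((monomialGraph V).Adj p i ∧ (monomialGraph V).Adj q r) := by
  obtain ⟨γ, hγ⟩ := isProjectiveIdentity_comp_iff.1 hW.left_inv
  have hsum : ∀ i, ∃ j j', V j + V j' = γ + Finsupp.single i 1 := by
    intro i
    obtain ⟨j, j', hj⟩ := eq_single_add_single_of_degree_eq_two (hW2 i)
    exact ⟨j, j', by rw [← hγ i, hj, sum_single_add_single_smul]⟩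
  have hdeg : γ.degree = 3 := by
    obtain ⟨j, j', h⟩ := hsum ⟨0, by omega⟩
    have := congrArg Finsupp.degree h
    rw [map_add, map_add, hV.stochastic, hV.stochastic, Finsupp.degree_single] at this
    omega
  obtain ⟨p, q, r, rfl⟩ := eq_single_add_single_add_single_of_degree_eq_three hdeg
  refine ⟨p, q, r, fun i => ?_⟩
  obtain ⟨j, j', h⟩ := hsum i
  exact pairing_of_add_eq (P := (monomialGraph V).Adj) (fun h => h.symm) (hV.stochastic j)
    (fun h => ⟨j, h⟩) (fun h => ⟨j', h⟩) h

/-- A star would give all monomials a common factor. -/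
lemma IsCremonaSet.exists_not_adj (hV : IsCremonaSet k 2 V) (x : Fin n) :
    ∃ i, ¬ (monomialGraph V).Adj x i := by
  by_contra! h
  obtain ⟨E, hE⟩ := exists_perm_of_injective
    (Q := fun i j => V j = Finsupp.single x 1 + Finsupp.single i 1) h (fun i i' j hi hi' => by
      have := single_add_single_inj (hi.symm.trans hi')
      grind)
  obtain ⟨j, hj⟩ := hV.canonical.1 x
  rw [← E.apply_symm_apply j, hE] at hj
  simp at hj

/-- Two different loops would be two circuits. -/
lemma IsCremonaSet.eq_of_adj_self (hV : IsCremonaSet k 2 V) {x y : Fin n}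
    (hx : (monomialGraph V).Adj x x) (hy : (monomialGraph V).Adj y y) : x = y := by
  obtain ⟨j, hj⟩ := hx
  obtain ⟨j', hj'⟩ := hy
  have := hV.circuit_unique (isCircuit_singleton hj) (isCircuit_singleton hj')
  rw [Finset.singleton_inj] at this
  subst this
  rcases hj.eq_and_eq_or_eq_and_eq hj' with h | h <;> exact h.1

lemma IsCremonaSet.exists_loopForm_of_cubic (hV : IsCremonaSet k 2 V) {x y : Fin n}
    (h : ∀ i, ((monomialGraph V).Adj x x ∧ (monomialGraph V).Adj y i) ∨
      ((monomialGraph V).Adj x y ∧ (monomialGraph V).Adj x i)) :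
    ∃ E, LoopForm V x y E := by
  obtain ⟨i₀, hi₀⟩ := hV.exists_not_adj x
  have hxy : x ≠ y := by
    rintro rfl
    have := h i₀
    tauto
  have hx : (monomialGraph V).Adj x x ∧ (monomialGraph V).Adj x y := by
    rcases h x with h | h
    · exact ⟨h.1, h.2.symm⟩
    · exact ⟨h.2, h.1⟩
  exact exists_loopForm hxy hx.1 hx.2 fun i _ _ => (h i).symm.imp And.right And.right

/-- The combinatorics of a cubic monomial `x_p x_q x_r` as in `IsCremonaSet.exists_cubic`. If it
is squarefree, all edges of the triangle `p q r` are present: the ends of a missing edge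
would both carry loops. -/
lemma square_or_triangle_of_cubic {α : Type*} {P : α → α → Prop}
    (symm : ∀ {u v}, P u v → P v u) (loop : ∀ {u v}, P u u → P v v → u = v) {p q r : α}
    (h : ∀ i, (P p q ∧ P r i) ∨ (P p r ∧ P q i) ∨ (P p i ∧ P q r)) :
    (∃ x y, ∀ i, (P x x ∧ P y i) ∨ (P x y ∧ P x i)) ∨
      (p ≠ q ∧ p ≠ r ∧ q ≠ r ∧ P p q ∧ P p r ∧ P q r) := by
  by_cases hpq : p = q
  · subst hpq
    refine Or.inl ⟨p, r, fun i => ?_⟩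
    rcases h i with h | h | h
    exacts [Or.inl h, Or.inr h, Or.inr h.symm]
  by_cases hpr : p = r
  · subst hpr
    refine Or.inl ⟨p, q, fun i => ?_⟩
    rcases h i with h | h | h
    exacts [Or.inr h, Or.inl h, Or.inr ⟨symm h.2, h.1⟩]
  by_cases hqr : q = r
  · subst hqr
    refine Or.inl ⟨q, p, fun i => ?_⟩
    rcases h i with h | h | h
    exacts [Or.inr ⟨symm h.1, h.2⟩, Or.inr ⟨symm h.1, h.2⟩, Or.inl h.symm]
  refine Or.inr ⟨hpq, hpr, hqr, ?_⟩
  have hp := h p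
  have hq := h q
  have hr := h r
  have l1 := fun hp hq => hpq (loop hp hq)
  have l2 := fun hp hr => hpr (loop hp hr)
  have l3 := fun hq hr => hqr (loop hq hr)
  have s1 : P q p → P p q := symm
  have s2 : P r p → P p r := symm
  have s3 : P r q → P q r := symm
  grind

lemma IsCremonaSet.exists_normalForm (hV : IsCremonaSet k 2 V) (hn : 2 ≤ n)
    (hW : IsInverseSet k V W) (hW2 : IsStochastic 2 W) :
    (∃ a b c E, TriangleForm V a b c E) ∨ ∃ x y E, LoopForm V x y E := by
  obtain ⟨p, q, r, h⟩ := hV.exists_cubic hn hW hW2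
  rcases square_or_triangle_of_cubic (fun h => h.symm) hV.eq_of_adj_self h with
    ⟨x, y, hxy⟩ | ⟨hpq, hpr, hqr, e1, e2, e3⟩
  · exact Or.inr ⟨x, y, hV.exists_loopForm_of_cubic hxy⟩
  · refine Or.inl ⟨p, q, r, exists_triangleForm hpq hpr hqr e1 e2 e3 fun i _ _ _ => ?_⟩
    rcases h i with h | h | h
    exacts [Or.inr (Or.inr h.2), Or.inr (Or.inl h.2), Or.inl h.1]

end NormalForms

/-! ### Graph invariants of the normal forms -/

section Invariants

variable {k : Type*} [Field k] {n : ℕ} {V : Fin n → (Fin n →₀ ℕ)} {K : Finset (Fin n)}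

lemma mem_ball_succ_of_adj {α β : Type*} {G : Graph α β} {S : Set α} {r : ℕ} {u v : α}
    (hu : u ∈ ball G S r) (h : G.Adj u v) : v ∈ ball G S (r + 1) :=
  Or.inr ⟨u, hu, h⟩

lemma TriangleForm.card_and_neighborhoodSize {a b c : Fin n} {E : Equiv.Perm (Fin n)}
    (h : TriangleForm V a b c E) (hV : IsCremonaSet k 2 V) (hK : IsCircuit (monomialGraph V) K) :
    K.card = 3 ∧ neighborhoodSize (monomialGraph V) K 2 = 0 := by
  have hab := h.ne_ab
  have hac := h.ne_ac
  have hbc := h.ne_bc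
  have hK' : IsCircuit (monomialGraph V) {E c, E a, E b} := by
    refine ⟨2, ![a, b, c], ![E c, E a, E b], ?_, ?_, ?_, ?_⟩
    · intro i j hij
      fin_cases i <;> fin_cases j <;> simp_all
    · intro i j hij
      fin_cases i <;> fin_cases j <;> simp_all
    · intro i
      fin_cases i
      · exact h.edge_c
      · exact h.edge_a
      · exact h.edge_b.trans (add_comm _ _)
    · ext j
      simp
      tauto
  obtain rfl := hV.circuit_unique hK hK'
  refine ⟨?_, ?_⟩
  · rw [Finset.card_insert_of_notMem, Finset.card_pair] <;>
      simp [hab, hac.symm, hbc.symm]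
  · have hc : (monomialGraph V).IsLink (E c) a b := h.edge_c
    have ha : (monomialGraph V).IsLink (E a) b c := h.edge_a
    have h0a : a ∈ ball (monomialGraph V) (vertices (monomialGraph V) {E c, E a, E b}) 0 :=
      ⟨E c, by simp, hc.inc_left⟩
    have h0b : b ∈ ball (monomialGraph V) (vertices (monomialGraph V) {E c, E a, E b}) 0 :=
      ⟨E c, by simp, hc.inc_right⟩
    have h0c : c ∈ ball (monomialGraph V) (vertices (monomialGraph V) {E c, E a, E b}) 0 :=
      ⟨E a, by simp, ha.inc_right⟩
    have hball : ∀ i,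
        i ∈ ball (monomialGraph V) (vertices (monomialGraph V) {E c, E a, E b}) 1 := by
      intro i
      by_cases hia : i = a
      · exact Or.inl (hia ▸ h0a)
      by_cases hib : i = b
      · exact Or.inl (hib ▸ h0b)
      by_cases hic : i = c
      · exact Or.inl (hic ▸ h0c)
      rcases h.leaf i hia hib hic with hi | hi | hi
      · exact mem_ball_succ_of_adj h0a ⟨E i, hi⟩
      · exact mem_ball_succ_of_adj h0b ⟨E i, hi⟩
      · exact mem_ball_succ_of_adj h0c ⟨E i, hi⟩
    rw [neighborhoodSize, Set.ncard_eq_zero]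
    refine Set.eq_empty_of_forall_notMem fun e he => ?_
    obtain ⟨_, _, v, hv, _⟩ := he
    exact hv.2 (hball v)

lemma vertices_singleton_loop {α β : Type*} {G : Graph α β} {j : β} {x : α}
    (h : G.IsLink j x x) : vertices G {j} = {x} := by
  ext v
  simp only [vertices, Finset.mem_singleton, exists_eq_left, Set.mem_ofPred_eq,
    Set.mem_singleton_iff]
  constructor
  · intro hv
    rcases hv.eq_or_eq_of_isLink h with h | h <;> exact h
  · rintro rfl
    exact h.inc_left

lemma LoopForm.card_and_numBranching {x y : Fin n} {E : Equiv.Perm (Fin n)}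
    (h : LoopForm V x y E) (hV : IsCremonaSet k 2 V) (hK : IsCircuit (monomialGraph V) K) :
    K.card = 1 ∧ numBranching (monomialGraph V) K = 1 := by
  have hxy := h.ne
  obtain rfl := hV.circuit_unique hK (isCircuit_singleton h.loop)
  refine ⟨Finset.card_singleton _, ?_⟩
  rw [numBranching, Set.ncard_eq_one, vertices_singleton_loop h.loop]
  -- The ends of the edges are known, as every edge is `E i` for some `i`.
  have hinc : ∀ i v, (monomialGraph V).Inc (E i) v → v = i ∨ v = x ∨ v = y := by
    rintro i v ⟨w, hw⟩
    have hw : V (E i) = Finsupp.single v 1 + Finsupp.single w 1 := hw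
    by_cases hix : i = x
    · rw [hix, h.edge] at hw
      have := single_add_single_inj hw
      grind
    by_cases hiy : i = y
    · rw [hiy, h.loop] at hw
      have := single_add_single_inj hw
      grind
    rcases h.leaf i hix hiy with hi | hi <;>
    · rw [hi] at hw
      have := single_add_single_inj hw
      grind
  refine ⟨y, Set.eq_singleton_iff_unique_mem.2 ⟨⟨Set.mem_univ _, hxy.symm, ?_⟩, ?_⟩⟩
  · -- Besides `x y`, some edge at `y` avoids `x`, as `x` is not a common factor.
    obtain ⟨j, hj⟩ := hV.canonical.1 x
    obtain ⟨i, rfl⟩ := E.surjective j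
    have hix : i ≠ x := by
      rintro rfl
      simp [h.edge] at hj
    have hiy : i ≠ y := by
      rintro rfl
      simp [h.loop] at hj
    have hi : V (E i) = Finsupp.single y 1 + Finsupp.single i 1 := by
      refine (h.leaf i hix hiy).resolve_left fun hi => ?_
      simp [hi] at hj
    have hsub : ({E x, E i} : Set (Fin n)) ⊆ (monomialGraph V).incidenceSet y := by
      rintro e (rfl | rfl)
      · exact (show (monomialGraph V).IsLink (E x) x y from h.edge).inc_right
      · exact (show (monomialGraph V).IsLink (E i) y i from hi).inc_left
    have := Set.ncard_le_ncard hsub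
    rw [Set.ncard_pair (by simpa using hix.symm)] at this
    exact this.trans (Nat.le_add_right _ _)
  · rintro i ⟨-, hix, hdeg⟩
    by_contra hiy
    have hsub : (monomialGraph V).incidenceSet i ⊆ {E i} := by
      intro e he
      obtain ⟨i', rfl⟩ := E.surjective e
      rcases hinc i' i he with h' | h' | h'
      · rw [h']; rfl
      · exact absurd h' hix
      · exact absurd h' hiy
    have hloop : (monomialGraph V).loopSet i = ∅ := by
      refine Set.eq_empty_of_forall_notMem fun e he => ?_
      have hee : e = E i := hsub ((monomialGraph V).loopSet_subset_incidenceSet i he)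
      have he : V e = Finsupp.single i 1 + Finsupp.single i 1 := he
      rw [hee] at he
      rcases h.leaf i hix hiy with hi | hi <;>
      · rw [hi] at he
        have := single_add_single_inj he
        grind
    have := Set.ncard_le_ncard hsub
    rw [Set.ncard_singleton] at this
    rw [vertexDegree, hloop, Set.ncard_empty] at hdeg
    omega

/-! ### Recovering the normal forms from the graph invariants -/

/-- If no edge enters the second neighborhood, then by connectedness all vertices are at
distance at most one from the circuit. -/
lemma IsCremonaSet.exists_triangleForm_of_neighborhoodSize (hV : IsCremonaSet k 2 V)
    (hK : IsCircuit (monomialGraph V) K) (hcard : K.card = 3)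
    (hs : neighborhoodSize (monomialGraph V) K 2 = 0) : ∃ a b c E, TriangleForm V a b c E := by
  classical
  obtain ⟨m, vert, edge, hvert, hedge, hlink, hKe⟩ := hK
  have hm : m = 2 := by
    have h1 : K = Finset.univ.image edge := by
      ext j
      rw [← Finset.mem_coe, hKe]
      simp
    rw [h1, Finset.card_image_of_injective _ hedge] at hcard
    simpa using hcard
  subst hm
  have hmem : ∀ i, edge i ∈ K := fun i => by
    rw [← Finset.mem_coe, hKe]
    exact ⟨i, rfl⟩
  have hvertices : ∀ u ∈ vertices (monomialGraph V) K, u = vert 0 ∨ u = vert 1 ∨ u = vert 2 := by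
    rintro u ⟨e, he, hu⟩
    rw [← Finset.mem_coe, hKe] at he
    obtain ⟨i, rfl⟩ := he
    have := hu.eq_or_eq_of_isLink (hlink i)
    fin_cases i
    · exact this.elim Or.inl fun h => Or.inr (Or.inl h)
    · exact Or.inr this
    · exact this.elim (fun h => Or.inr (Or.inr h)) Or.inl
  have h0 : vert 0 ∈ vertices (monomialGraph V) K := ⟨edge 0, hmem 0, (hlink 0).inc_left⟩
  rw [neighborhoodSize, Set.ncard_eq_zero] at hs
  have hclosed : ∀ j u v, V j = Finsupp.single u 1 + Finsupp.single v 1 →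
      u ∈ ball (monomialGraph V) (vertices (monomialGraph V) K) 1 →
      v ∈ ball (monomialGraph V) (vertices (monomialGraph V) K) 1 := by
    intro j u v hj hu
    by_contra hv
    have : j ∈ (∅ : Set (Fin n)) := by
      rw [← hs]
      exact ⟨u, hu, v, ⟨mem_ball_succ_of_adj hu ⟨j, hj⟩, hv⟩, hj⟩
    exact this
  have hball := hV.mem_of_closed hclosed (u := vert 0) (Or.inl h0)
  refine ⟨vert 0, vert 1, vert 2, exists_triangleForm (hvert.ne (by decide))
    (hvert.ne (by decide)) (hvert.ne (by decide)) (hlink 0).adj (hlink 2).symm.adj (hlink 1).adj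
    fun i hia hib hic => ?_⟩
  rcases hball i with hi | ⟨u, hu, hui⟩
  · rcases hvertices i hi with h | h | h
    exacts [absurd h hia, absurd h hib, absurd h hic]
  · rcases hvertices u hu with rfl | rfl | rfl
    exacts [Or.inl hui, Or.inr (Or.inl hui), Or.inr (Or.inr hui)]

/-- All vertices except the loop vertex `x` and the one branching vertex `y` are leaves. By
connectedness, they are attached to `x` or `y`, and `x` is joined to `y`. -/
lemma IsCremonaSet.exists_loopForm_of_numBranching (hV : IsCremonaSet k 2 V)
    (hK : IsCircuit (monomialGraph V) K) (hcard : K.card = 1)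
    (hs : numBranching (monomialGraph V) K = 1) : ∃ x y E, LoopForm V x y E := by
  obtain ⟨m, vert, edge, hvert, hedge, hlink, hKe⟩ := hK
  obtain ⟨l, rfl⟩ := Finset.card_eq_one.1 hcard
  have hm : m = 0 := by
    have h0 : edge 0 = l := by simpa using hKe.symm.subset ⟨0, rfl⟩
    have hl : edge (Fin.last m) = l := by simpa using hKe.symm.subset ⟨Fin.last m, rfl⟩
    have := congrArg Fin.val (hedge (h0.trans hl.symm))
    simpa using this.symm
  subst hm
  obtain ⟨x, hx⟩ : ∃ x, (monomialGraph V).IsLink l x x := by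
    have h0 : edge 0 = l := by simpa using hKe.symm.subset ⟨0, rfl⟩
    exact ⟨vert 0, h0 ▸ hlink 0⟩
  rw [numBranching, Set.ncard_eq_one, vertices_singleton_loop hx] at hs
  obtain ⟨y, hy⟩ := hs
  have hyx : y ≠ x := (hy.symm.subset rfl).2.1
  have hleaf : ∀ i, i ≠ x → i ≠ y → ∀ {j j' u v}, (monomialGraph V).IsLink j i u →
      (monomialGraph V).IsLink j' i v → u = v := by
    intro i hix hiy j j' u v hj hj'
    have hdeg : ¬ 2 ≤ vertexDegree (monomialGraph V) i := fun h =>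
      hiy (hy.subset ⟨Set.mem_univ _, hix, h⟩)
    have hle : ((monomialGraph V).incidenceSet i).ncard ≤ 1 := by
      rw [vertexDegree] at hdeg
      omega
    have hjj := (Set.ncard_le_one (Set.toFinite _)).1 hle j hj.inc_left j' hj'.inc_left
    subst hjj
    exact hj.right_unique hj'
  refine ⟨x, y, exists_loopForm hyx.symm hx.adj ?_ fun i hix hiy => ?_⟩
  · -- Otherwise `y` and its leaves form a component that misses `x`.
    by_contra hxy
    have := hV.mem_of_closed (S := {t | t = y ∨ t ≠ x ∧ t ≠ y ∧ (monomialGraph V).Adj y t})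
      (fun j u v hj hu => by
        have hj : (monomialGraph V).IsLink j u v := hj
        by_cases hvy : v = y
        · exact Or.inl hvy
        rcases hu with rfl | ⟨hux, huy, j', hj'⟩
        · exact Or.inr ⟨fun hvx => hxy (hvx ▸ hj.symm.adj), hvy, hj.adj⟩
        · exact Or.inl (hleaf u hux huy hj hj'.symm)) (Or.inl rfl) x
    rcases this with h | h
    · exact hyx h.symm
    · exact h.1 rfl
  · obtain ⟨j, hj⟩ := hV.canonical.2 i
    obtain ⟨t, ht⟩ : ∃ t, (monomialGraph V).IsLink j i t := by
      obtain ⟨u, v, huv⟩ := hV.exists_eq j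
      have hl : (monomialGraph V).IsLink j u v := huv
      rw [huv] at hj
      by_cases hui : u = i
      · exact ⟨v, hui ▸ hl⟩
      by_cases hvi : v = i
      · exact ⟨u, hvi ▸ hl.symm⟩
      simp [hui, hvi] at hj
    by_cases htx : t = x
    · exact Or.inl (htx ▸ ht.symm.adj)
    by_cases hty : t = y
    · exact Or.inr (hty ▸ ht.symm.adj)
    -- Two leaves joined to each other form a component that misses `x`.
    have := hV.mem_of_closed (S := {s | s = i ∨ s = t}) (fun j' u v hj' hu => by
      have hj' : (monomialGraph V).IsLink j' u v := hj'
      rcases hu with rfl | rfl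
      · exact Or.inr (hleaf u hix hiy hj' ht)
      · exact Or.inl (hleaf u htx hty hj' ht.symm)) (Or.inl rfl) x
    rcases this with h | h
    · exact absurd h.symm hix
    · exact absurd h.symm htx

end Invariants

end MonomialCremona

theorem mainTheorem2 (k : Type*) [Field k] (n : ℕ) (hn : 2 ≤ n)
    (V : Fin n → (Fin n →₀ ℕ)) (hV : MonomialCremona.IsCremonaSet k 2 V) :
    (∃! W : Fin n → (Fin n →₀ ℕ), MonomialCremona.IsInverseSet k V W) ∧
    (∃! K : Finset (Fin n), MonomialCremona.IsCircuit (MonomialCremona.monomialGraph V) K) ∧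
    ∀ (W : Fin n → (Fin n →₀ ℕ)) (K : Finset (Fin n)),
      MonomialCremona.IsInverseSet k V W →
      MonomialCremona.IsCircuit (MonomialCremona.monomialGraph V) K →
      List.TFAE [
        MonomialCremona.EqUpToPermutation V W,
        MonomialCremona.IsStochastic 2 W,
        (K.card = 3 ∧
            MonomialCremona.neighborhoodSize (MonomialCremona.monomialGraph V) K 2 = 0) ∨
          (K.card = 1 ∧
            MonomialCremona.numBranching (MonomialCremona.monomialGraph V) K = 1)] := by
  obtain ⟨W₀, hW₀⟩ := hV.exists_isInverseSet hn
  obtain ⟨K₀, hK₀⟩ := hV.exists_isCircuit hn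
  refine ⟨⟨W₀, hW₀, fun W hW => hV.inverseSet_unique hW hW₀⟩,
    ⟨K₀, hK₀, fun K hK => hV.circuit_unique hK hK₀⟩, fun W K hW hK => ?_⟩
  tfae_have 1 → 2 := fun h => h.isStochastic hV.stochastic
  tfae_have 2 → 3 := fun h => by
    rcases hV.exists_normalForm hn hW h with ⟨a, b, c, E, hE⟩ | ⟨x, y, E, hE⟩
    · exact Or.inl (hE.card_and_neighborhoodSize hV hK)
    · exact Or.inr (hE.card_and_numBranching hV hK)
  tfae_have 3 → 1 := fun h => by
    rcases h with ⟨h3, hs⟩ | ⟨h1, hs⟩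
    · obtain ⟨a, b, c, E, hE⟩ := hV.exists_triangleForm_of_neighborhoodSize hK h3 hs
      exact hE.eqUpToPermutation hV hW
    · obtain ⟨x, y, E, hE⟩ := hV.exists_loopForm_of_numBranching hK h1 hs
      exact hE.eqUpToPermutation hV hW
  tfae_finish
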